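/- Let $n\ge 2$ and $m\ge 3$ be integers, and let $K$ be a field containing a primitive $m$-th root of unity $q$. Let $U_n(K)=\{\omega\in K : \omega^n=1\}$ be the cyclic group of $n$-th roots of unity in $K$ and $\nu(n)=|U_n(K)|$ its order. For $\omega\in U_n(K)$ let $T^{\omega}_{nm^2}(q)$ denote the Hopf algebra over $K$ generated as a unital associative algebra by $g,h,x$ subject to the relations $$g^n=h^m=1,\qquad x^m=0,\qquad xh=q\,hx,\qquad hg=gh,\qquad gx=\omega\,xg,$$ with comultiplication, counit and antipode determined by $$\Delta(g)=g\otimes g,\qquad \Delta(h)=h\otimes h,\qquad \Delta(x)=x\otimes h+1\otimes x,$$ $$\varepsilon(g)=\varepsilon(h)=1,\qquad \varepsilon(x)=0,\qquad S(g)=g^{n-1},\qquad S(h)=h^{m-1},\qquad S(x)=-x h^{m-1}.$$ Let $\xi$ be a generator of $U_n(K)$ and let $t,t'\in\{0,1,\dots,\nu(n)-1\}$. Then the Hopf algebras $T^{\xi^{t}}_{nm^2}(q)$ and $T^{\xi^{t'}}_{nm^2}(q)$ are isomorphic if and only if there exist $l\in\{0,1,\dots,m-1\}$ and $s\in\{0,1,\dots,n-1\}$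 such that $\gcd(s,n)=1$ and $\xi^{st'-t}=q^{l}$. -/

import Mathlib

open scoped TensorProduct

/-! ### The `q`-binomial theorem at a primitive root of unity

These facts are needed only to see that the comultiplication below respects `x ^ m = 0`. -/

namespace QBinomial

/-- The `q`-integer `1 + q + ⋯ + q ^ (k - 1)`. -/
def qInt {K : Type*} [Field K] (q : K) (k : ℕ) : K := ∑ i ∈ Finset.range k, q ^ i

/-- The `q`-factorial. -/
def qFact {K : Type*} [Field K] (q : K) (k : ℕ) : K := ∏ i ∈ Finset.range k, qInt q (i + 1)

/-- The Gaussian binomial coefficient of `a ^ i * b ^ j` in `(a + b) ^ (i + j)`,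
where `b * a = q • (a * b)`. -/
def coeff {K : Type*} [Field K] (q : K) : ℕ → ℕ → K
  | 0, _ => 1
  | _ + 1, 0 => 1
  | i + 1, j + 1 => coeff q i (j + 1) + q ^ (i + 1) * coeff q (i + 1) j

theorem coeff_zero_right {K : Type*} [Field K] (q : K) (i : ℕ) : coeff q i 0 = 1 := by
  cases i <;> simp [coeff]

theorem coeff_zero_left {K : Type*} [Field K] (q : K) (j : ℕ) : coeff q 0 j = 1 := by
  simp [coeff]

theorem qFact_succ {K : Type*} [Field K] (q : K) (k : ℕ) :
    qFact q (k + 1) = qFact q k * qInt q (k + 1) := by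
  simp [qFact, Finset.prod_range_succ]

theorem qInt_add {K : Type*} [Field K] (q : K) (i j : ℕ) :
    qInt q (i + j) = qInt q i + q ^ i * qInt q j := by
  simp [qInt, Finset.sum_range_add, Finset.mul_sum, pow_add]

theorem coeff_mul_qFact {K : Type*} [Field K] (q : K) : ∀ i j : ℕ,
    coeff q i j * (qFact q i * qFact q j) = qFact q (i + j)
  | 0, j => by simp [coeff, qFact]
  | i + 1, 0 => by simp [coeff, qFact]
  | i + 1, j + 1 => by
    have h1 := coeff_mul_qFact q i (j + 1)
    have h2 := coeff_mul_qFact q (i + 1) j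
    have h3 : i + 1 + j = i + (j + 1) := by ring
    have h4 : i + 1 + (j + 1) = (i + (j + 1)) + 1 := by ring
    rw [h3] at h2
    have h5 : qInt q (i + (j + 1) + 1) = qInt q (i + 1) + q ^ (i + 1) * qInt q (j + 1) := by
      rw [← qInt_add, h4]
    rw [h4, qFact_succ q (i + (j + 1)), h5, mul_add]
    nth_rewrite 1 [← h1]
    rw [← h2, coeff, qFact_succ q i, qFact_succ q j]
    ring

theorem qInt_ne_zero {K : Type*} [Field K] {q : K} {m k : ℕ} (hq : IsPrimitiveRoot q m)
    (hk : 0 < k) (hkm : k < m) : qInt q k ≠ 0 := by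
  intro h
  have h1 : qInt q k * (q - 1) = q ^ k - 1 := geom_sum_mul q k
  rw [h, zero_mul] at h1
  exact hq.pow_ne_one_of_pos_of_lt hk.ne' hkm (sub_eq_zero.mp h1.symm)

theorem qFact_ne_zero {K : Type*} [Field K] {q : K} {m k : ℕ} (hq : IsPrimitiveRoot q m)
    (hkm : k < m) : qFact q k ≠ 0 := by
  rw [qFact, Finset.prod_ne_zero_iff]
  intro i hi
  have := Finset.mem_range.mp hi
  exact qInt_ne_zero hq (by omega) (by omega)

theorem coeff_eq_zero {K : Type*} [Field K] {q : K} {i j : ℕ}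
    (hq : IsPrimitiveRoot q (i + j)) (hi : 0 < i) (hj : 0 < j) : coeff q i j = 0 := by
  have h := coeff_mul_qFact q i j
  have h0 : qFact q (i + j) = 0 := by
    obtain ⟨k, hk⟩ : ∃ k, i + j = k + 1 := ⟨i + j - 1, by omega⟩
    have h1 : qInt q (i + j) = 0 := hq.geom_sum_eq_zero (by omega)
    rw [hk] at h1 ⊢
    rw [qFact_succ, h1, mul_zero]
  rw [h0] at h
  exact (mul_eq_zero.mp h).resolve_right
    (mul_ne_zero (qFact_ne_zero hq (by omega)) (qFact_ne_zero hq (by omega)))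

theorem mul_pow_of_skew {K A : Type*} [Field K] [Ring A] [Algebra K A] {q : K} {a b : A}
    (hab : b * a = q • (a * b)) (k : ℕ) : b * a ^ k = q ^ k • (a ^ k * b) := by
  induction k with
  | zero => simp
  | succ k ih =>
    rw [pow_succ, ← mul_assoc, ih, smul_mul_assoc, mul_assoc, hab, mul_smul_comm, smul_smul,
      ← mul_assoc, pow_succ]

theorem qAdd_pow {K A : Type*} [Field K] [Ring A] [Algebra K A] {q : K} {a b : A}
    (hab : b * a = q • (a * b)) (k : ℕ) :
    (a + b) ^ k = ∑ p ∈ Finset.HasAntidiagonal.antidiagonal k, coeff q p.1 p.2 • (a ^ p.1 * b ^ p.2) := by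
  induction k with
  | zero => simp [coeff]
  | succ k ih =>
    have e1 : ∀ i j : ℕ, (a + b) * (coeff q i j • (a ^ i * b ^ j)) =
        coeff q i j • (a ^ (i + 1) * b ^ j) + (q ^ i * coeff q i j) • (a ^ i * b ^ (j + 1)) := by
      intro i j
      rw [mul_smul_comm, add_mul, smul_add, ← mul_assoc, ← mul_assoc, ← pow_succ',
        mul_pow_of_skew hab, smul_mul_assoc, mul_assoc (a ^ i), ← pow_succ', smul_smul,
        mul_comm (coeff q i j)]
    rw [pow_succ', ih, Finset.mul_sum]
    simp only [e1, Finset.sum_add_distrib]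
    cases k with
    | zero => simp [coeff, Finset.Nat.antidiagonal_succ, add_comm]
    | succ k =>
      rw [Finset.Nat.sum_antidiagonal_succ' (n := k)
        (f := fun p : ℕ × ℕ => coeff q p.1 p.2 • (a ^ (p.1 + 1) * b ^ p.2))]
      rw [Finset.Nat.sum_antidiagonal_succ (n := k)
        (f := fun p : ℕ × ℕ => (q ^ p.1 * coeff q p.1 p.2) • (a ^ p.1 * b ^ (p.2 + 1)))]
      rw [Finset.Nat.sum_antidiagonal_succ (n := k + 1), Finset.Nat.sum_antidiagonal_succ' (n := k)]
      simp only [coeff, coeff_zero_right, coeff_zero_left, add_smul, Finset.sum_add_distrib,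
        pow_zero, one_mul, mul_one, one_smul]
      abel

theorem qAdd_pow_eq {K A : Type*} [Field K] [Ring A] [Algebra K A] {q : K} {m : ℕ} [NeZero m]
    (hq : IsPrimitiveRoot q m) {a b : A} (hab : b * a = q • (a * b)) :
    (a + b) ^ m = a ^ m + b ^ m := by
  obtain ⟨k, rfl⟩ : ∃ k, m = k + 1 := ⟨m - 1, by have := NeZero.pos m; omega⟩
  rw [qAdd_pow hab]
  cases k with
  | zero => simp [coeff, Finset.Nat.antidiagonal_succ, add_comm]
  | succ k =>
    rw [Finset.Nat.sum_antidiagonal_succ (n := k + 1), Finset.Nat.sum_antidiagonal_succ' (n := k),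
      Finset.sum_eq_zero]
    · simp [coeff, coeff_zero_right, add_comm]
    · rintro ⟨i, j⟩ hp
      have hp' : i + j = k := by simpa using hp
      have h : IsPrimitiveRoot q ((i + 1) + (j + 1)) := by
        have : i + 1 + (j + 1) = k + 1 + 1 := by omega
        rwa [this]
      simp [coeff_eq_zero h]

end QBinomial

/-! ### The Hopf algebra `T_{nm²}^ω(q)` -/

/-- The three generators. -/
inductive TaftGen : Type
  | g | h | x

/-- The defining relations
`gⁿ = hᵐ = 1`, `xᵐ = 0`, `x h = q h x`, `h g = g h`, `g x = ω x g`. -/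
inductive TaftRel {K : Type*} [Field K] (n m : ℕ) (q ω : K) :
    FreeAlgebra K TaftGen → FreeAlgebra K TaftGen → Prop
  | g_pow : TaftRel n m q ω (FreeAlgebra.ι K TaftGen.g ^ n) 1
  | h_pow : TaftRel n m q ω (FreeAlgebra.ι K TaftGen.h ^ m) 1
  | x_pow : TaftRel n m q ω (FreeAlgebra.ι K TaftGen.x ^ m) 0
  | x_h : TaftRel n m q ω (FreeAlgebra.ι K TaftGen.x * FreeAlgebra.ι K TaftGen.h)
      (q • (FreeAlgebra.ι K TaftGen.h * FreeAlgebra.ι K TaftGen.x))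
  | h_g : TaftRel n m q ω (FreeAlgebra.ι K TaftGen.h * FreeAlgebra.ι K TaftGen.g)
      (FreeAlgebra.ι K TaftGen.g * FreeAlgebra.ι K TaftGen.h)
  | g_x : TaftRel n m q ω (FreeAlgebra.ι K TaftGen.g * FreeAlgebra.ι K TaftGen.x)
      (ω • (FreeAlgebra.ι K TaftGen.x * FreeAlgebra.ι K TaftGen.g))

/-- The unital associative `K`-algebra `T_{nm²}^ω(q)` presented by the generators `g`, `h`, `x`
and the relations `TaftRel`. -/
def TaftT {K : Type*} [Field K] (n m : ℕ) (q ω : K) : Type _ := RingQuot (TaftRel n m q ω)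

namespace TaftT

noncomputable section

instance {K : Type*} [Field K] (n m : ℕ) (q ω : K) : Ring (TaftT n m q ω) :=
  inferInstanceAs (Ring (RingQuot (TaftRel n m q ω)))

instance {K : Type*} [Field K] (n m : ℕ) (q ω : K) : Algebra K (TaftT n m q ω) :=
  inferInstanceAs (Algebra K (RingQuot (TaftRel n m q ω)))

/-- The quotient map from the free algebra. -/
def mk {K : Type*} [Field K] (n m : ℕ) (q ω : K) : FreeAlgebra K TaftGen →ₐ[K] TaftT n m q ω :=
  RingQuot.mkAlgHom K (TaftRel n m q ω)

/-- The generator `g`. -/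
def g {K : Type*} [Field K] (n m : ℕ) (q ω : K) : TaftT n m q ω :=
  mk n m q ω (FreeAlgebra.ι K TaftGen.g)

/-- The generator `h`. -/
def h {K : Type*} [Field K] (n m : ℕ) (q ω : K) : TaftT n m q ω :=
  mk n m q ω (FreeAlgebra.ι K TaftGen.h)

/-- The generator `x`. -/
def x {K : Type*} [Field K] (n m : ℕ) (q ω : K) : TaftT n m q ω :=
  mk n m q ω (FreeAlgebra.ι K TaftGen.x)

section relations

variable {K : Type*} [Field K] (n m : ℕ) (q ω : K)

theorem mk_rel {a b : FreeAlgebra K TaftGen} (hab : TaftRel n m q ω a b) :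
    mk n m q ω a = mk n m q ω b := RingQuot.mkAlgHom_rel K hab

theorem g_pow : g n m q ω ^ n = 1 := by simpa [g] using mk_rel n m q ω .g_pow

theorem h_pow : h n m q ω ^ m = 1 := by simpa [h] using mk_rel n m q ω .h_pow

theorem x_pow : x n m q ω ^ m = 0 := by simpa [x] using mk_rel n m q ω .x_pow

theorem x_mul_h : x n m q ω * h n m q ω = q • (h n m q ω * x n m q ω) := by
  simpa [x, h] using mk_rel n m q ω .x_h

theorem h_mul_g : h n m q ω * g n m q ω = g n m q ω * h n m q ω := by
  simpa [g, h] using mk_rel n m q ω .h_g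

theorem g_mul_x : g n m q ω * x n m q ω = ω • (x n m q ω * g n m q ω) := by
  simpa [g, x] using mk_rel n m q ω .g_x

end relations

/-- The universal property of the presentation. -/
def lift {K : Type*} [Field K] {n m : ℕ} {q ω : K} {B : Type*} [Ring B] [Algebra K B]
    (g' h' x' : B) (hg : g' ^ n = 1) (hh : h' ^ m = 1) (hx : x' ^ m = 0)
    (hxh : x' * h' = q • (h' * x')) (hhg : h' * g' = g' * h') (hgx : g' * x' = ω • (x' * g')) :
    TaftT n m q ω →ₐ[K] B :=
  RingQuot.liftAlgHom K ⟨FreeAlgebra.lift K fun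
    | TaftGen.g => g'
    | TaftGen.h => h'
    | TaftGen.x => x', by
    intro a b hab
    cases hab <;> simpa⟩

section lift

variable {K : Type*} [Field K] {n m : ℕ} {q ω : K} {B : Type*} [Ring B] [Algebra K B]
    (g' h' x' : B) (hg : g' ^ n = 1) (hh : h' ^ m = 1) (hx : x' ^ m = 0)
    (hxh : x' * h' = q • (h' * x')) (hhg : h' * g' = g' * h') (hgx : g' * x' = ω • (x' * g'))

theorem lift_g : lift g' h' x' hg hh hx hxh hhg hgx (g n m q ω) = g' := by
  rw [lift, g, mk]
  exact (RingQuot.liftAlgHom_mkAlgHom_apply ..).trans (by simp)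

theorem lift_h : lift g' h' x' hg hh hx hxh hhg hgx (h n m q ω) = h' := by
  rw [lift, h, mk]
  exact (RingQuot.liftAlgHom_mkAlgHom_apply ..).trans (by simp)

theorem lift_x : lift g' h' x' hg hh hx hxh hhg hgx (x n m q ω) = x' := by
  rw [lift, x, mk]
  exact (RingQuot.liftAlgHom_mkAlgHom_apply ..).trans (by simp)

end lift

theorem induction {K : Type*} [Field K] {n m : ℕ} {q ω : K} {P : TaftT n m q ω → Prop}
    (hK : ∀ r : K, P (algebraMap K _ r)) (hg : P (g n m q ω)) (hh : P (h n m q ω))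
    (hx : P (x n m q ω)) (hmul : ∀ a b, P a → P b → P (a * b))
    (hadd : ∀ a b, P a → P b → P (a + b)) (a : TaftT n m q ω) : P a := by
  obtain ⟨a, rfl⟩ : ∃ b, mk n m q ω b = a := RingQuot.mkAlgHom_surjective K _ a
  induction a using FreeAlgebra.induction with
  | grade0 r => simpa using hK r
  | grade1 y => cases y <;> assumption
  | mul a b ha hb => simpa using hmul _ _ ha hb
  | add a b ha hb => simpa using hadd _ _ ha hb

theorem algHom_ext {K : Type*} [Field K] {n m : ℕ} {q ω : K} {B : Type*} [Semiring B]
    [Algebra K B] {f f' : TaftT n m q ω →ₐ[K] B} (hg : f (g n m q ω) = f' (g n m q ω))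
    (hh : f (h n m q ω) = f' (h n m q ω)) (hx : f (x n m q ω) = f' (x n m q ω)) : f = f' := by
  ext a
  induction a using TaftT.induction with
  | hK r => simp
  | hg => exact hg
  | hh => exact hh
  | hx => exact hx
  | hmul a b ha hb => simp [ha, hb]
  | hadd a b ha hb => simp [ha, hb]

section hopf

variable {K : Type*} [Field K] (n m : ℕ) (q ω : K)

theorem x_skew : ((1 : TaftT n m q ω) ⊗ₜ[K] x n m q ω) * (x n m q ω ⊗ₜ[K] h n m q ω) =
    q • ((x n m q ω ⊗ₜ[K] h n m q ω) * ((1 : TaftT n m q ω) ⊗ₜ[K] x n m q ω)) := by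
  simp [x_mul_h]

theorem tmul_g_pow : (g n m q ω ⊗ₜ[K] g n m q ω) ^ n = (1 : TaftT n m q ω ⊗[K] TaftT n m q ω) := by
  simp [g_pow, Algebra.TensorProduct.one_def]

theorem tmul_h_pow : (h n m q ω ⊗ₜ[K] h n m q ω) ^ m = (1 : TaftT n m q ω ⊗[K] TaftT n m q ω) := by
  simp [h_pow, Algebra.TensorProduct.one_def]

theorem tmul_x_pow [NeZero m] [hq : Fact (IsPrimitiveRoot q m)] :
    (x n m q ω ⊗ₜ[K] h n m q ω + 1 ⊗ₜ[K] x n m q ω) ^ m = (0 : TaftT n m q ω ⊗[K] TaftT n m q ω) := by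
  rw [QBinomial.qAdd_pow_eq hq.out (x_skew n m q ω)]
  simp [x_pow]

theorem tmul_x_mul_h : (x n m q ω ⊗ₜ[K] h n m q ω + 1 ⊗ₜ[K] x n m q ω) * (h n m q ω ⊗ₜ[K] h n m q ω) =
    q • ((h n m q ω ⊗ₜ[K] h n m q ω) * (x n m q ω ⊗ₜ[K] h n m q ω + 1 ⊗ₜ[K] x n m q ω)) := by
  simp [add_mul, mul_add, x_mul_h, TensorProduct.smul_tmul']

theorem tmul_h_mul_g : (h n m q ω ⊗ₜ[K] h n m q ω) * (g n m q ω ⊗ₜ[K] g n m q ω) = (g n m q ω ⊗ₜ[K] g n m q ω) * (h n m q ω ⊗ₜ[K] h n m q ω) := by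
  simp [h_mul_g]

theorem tmul_g_mul_x : (g n m q ω ⊗ₜ[K] g n m q ω) * (x n m q ω ⊗ₜ[K] h n m q ω + 1 ⊗ₜ[K] x n m q ω) =
    ω • ((x n m q ω ⊗ₜ[K] h n m q ω + 1 ⊗ₜ[K] x n m q ω) * (g n m q ω ⊗ₜ[K] g n m q ω)) := by
  simp [add_mul, mul_add, g_mul_x, h_mul_g, TensorProduct.smul_tmul']

/-- `Δ(g) = g ⊗ g`, `Δ(h) = h ⊗ h`, `Δ(x) = x ⊗ h + 1 ⊗ x`, extended to an algebra map. -/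
def comulHom [NeZero m] [Fact (IsPrimitiveRoot q m)] :
    TaftT n m q ω →ₐ[K] TaftT n m q ω ⊗[K] TaftT n m q ω :=
  lift (g n m q ω ⊗ₜ[K] g n m q ω) (h n m q ω ⊗ₜ[K] h n m q ω)
    (x n m q ω ⊗ₜ[K] h n m q ω + 1 ⊗ₜ[K] x n m q ω)
    (tmul_g_pow n m q ω) (tmul_h_pow n m q ω) (tmul_x_pow n m q ω) (tmul_x_mul_h n m q ω)
    (tmul_h_mul_g n m q ω) (tmul_g_mul_x n m q ω)

/-- `ε(g) = ε(h) = 1`, `ε(x) = 0`, extended to an algebra map. -/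
def counitHom [NeZero m] : TaftT n m q ω →ₐ[K] K :=
  lift 1 1 0 (by simp) (by simp) (by simp [NeZero.ne m]) (by simp) (by simp) (by simp)

theorem comulHom_g [NeZero m] [Fact (IsPrimitiveRoot q m)] :
    comulHom n m q ω (g n m q ω) = g n m q ω ⊗ₜ[K] g n m q ω := by
  rw [comulHom, lift_g]

theorem comulHom_h [NeZero m] [Fact (IsPrimitiveRoot q m)] :
    comulHom n m q ω (h n m q ω) = h n m q ω ⊗ₜ[K] h n m q ω := by
  rw [comulHom, lift_h]

theorem comulHom_x [NeZero m] [Fact (IsPrimitiveRoot q m)] :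
    comulHom n m q ω (x n m q ω) = x n m q ω ⊗ₜ[K] h n m q ω + 1 ⊗ₜ[K] x n m q ω := by
  rw [comulHom, lift_x]

theorem counitHom_g [NeZero m] : counitHom n m q ω (g n m q ω) = 1 := by
  rw [counitHom, lift_g]

theorem counitHom_h [NeZero m] : counitHom n m q ω (h n m q ω) = 1 := by
  rw [counitHom, lift_h]

theorem counitHom_x [NeZero m] : counitHom n m q ω (x n m q ω) = 0 := by
  rw [counitHom, lift_x]

instance [NeZero m] [Fact (IsPrimitiveRoot q m)] : Bialgebra K (TaftT n m q ω) :=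
  Bialgebra.ofAlgHom (comulHom n m q ω) (counitHom n m q ω)
    (by
      apply algHom_ext <;>
        simp [comulHom_g, comulHom_h, comulHom_x, Algebra.TensorProduct.one_def,
          TensorProduct.add_tmul, TensorProduct.tmul_add, add_assoc])
    (by
      apply algHom_ext <;>
        simp [comulHom_g, comulHom_h, comulHom_x, counitHom_g, counitHom_h, counitHom_x])
    (by
      apply algHom_ext <;>
        simp [comulHom_g, comulHom_h, comulHom_x, counitHom_g, counitHom_h, counitHom_x])

theorem g_inv [NeZero n] : g n m q ω ^ (n - 1) * g n m q ω = 1 := by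
  rw [← pow_succ, Nat.sub_add_cancel NeZero.one_le, g_pow]

theorem g_inv' [NeZero n] : g n m q ω * g n m q ω ^ (n - 1) = 1 := by
  rw [← pow_succ', Nat.sub_add_cancel NeZero.one_le, g_pow]

theorem h_inv [NeZero m] : h n m q ω ^ (m - 1) * h n m q ω = 1 := by
  rw [← pow_succ, Nat.sub_add_cancel NeZero.one_le, h_pow]

theorem h_inv' [NeZero m] : h n m q ω * h n m q ω ^ (m - 1) = 1 := by
  rw [← pow_succ', Nat.sub_add_cancel NeZero.one_le, h_pow]

theorem h_inv_mul_x [NeZero m] :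
    h n m q ω ^ (m - 1) * x n m q ω = q • (x n m q ω * h n m q ω ^ (m - 1)) := by
  calc h n m q ω ^ (m - 1) * x n m q ω
      = h n m q ω ^ (m - 1) * (x n m q ω * h n m q ω) * h n m q ω ^ (m - 1) := by
        rw [mul_assoc, mul_assoc, h_inv', mul_one]
    _ = q • (x n m q ω * h n m q ω ^ (m - 1)) := by
        rw [x_mul_h, mul_smul_comm, ← mul_assoc, h_inv, one_mul, smul_mul_assoc]

theorem x_mul_g_inv [NeZero n] :
    x n m q ω * g n m q ω ^ (n - 1) = ω • (g n m q ω ^ (n - 1) * x n m q ω) := by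
  calc x n m q ω * g n m q ω ^ (n - 1)
      = g n m q ω ^ (n - 1) * (g n m q ω * x n m q ω) * g n m q ω ^ (n - 1) := by
        rw [← mul_assoc, g_inv, one_mul]
    _ = ω • (g n m q ω ^ (n - 1) * x n m q ω) := by
        rw [g_mul_x, mul_smul_comm, smul_mul_assoc, mul_assoc, mul_assoc, g_inv', mul_one]

theorem commute_inv : Commute (h n m q ω ^ (m - 1)) (g n m q ω ^ (n - 1)) :=
  Commute.pow_pow (h_mul_g n m q ω) _ _

theorem x_mul_h_pow_pow (k j : ℕ) : ∃ c : K, (x n m q ω * h n m q ω ^ k) ^ j =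
    c • (h n m q ω ^ (k * j) * x n m q ω ^ j) := by
  induction j with
  | zero => exact ⟨1, by simp⟩
  | succ j ih =>
    obtain ⟨c, hc⟩ := ih
    refine ⟨c * q ^ (k * (j + 1)), ?_⟩
    rw [pow_succ', hc, mul_smul_comm, mul_smul, ← mul_assoc, mul_assoc (x n m q ω), ← pow_add,
      show k + k * j = k * (j + 1) by ring, QBinomial.mul_pow_of_skew (x_mul_h n m q ω),
      smul_mul_assoc, mul_assoc, ← pow_succ']

/-- `S(g) = gⁿ⁻¹`, `S(h) = hᵐ⁻¹`, `S(x) = -x hᵐ⁻¹`, extended to an algebra map into the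
opposite algebra. -/
def antipodeHom [NeZero n] [NeZero m] : TaftT n m q ω →ₐ[K] (TaftT n m q ω)ᵐᵒᵖ :=
  lift (MulOpposite.op (g n m q ω ^ (n - 1))) (MulOpposite.op (h n m q ω ^ (m - 1)))
    (MulOpposite.op (-(x n m q ω * h n m q ω ^ (m - 1))))
    (by
      apply MulOpposite.unop_injective
      simp [pow_right_comm _ (n - 1) n, g_pow])
    (by
      apply MulOpposite.unop_injective
      simp [pow_right_comm _ (m - 1) m, h_pow])
    (by
      apply MulOpposite.unop_injective
      obtain ⟨c, hc⟩ := x_mul_h_pow_pow n m q ω (m - 1) m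
      simp [neg_pow (x n m q ω * h n m q ω ^ (m - 1)), hc, x_pow])
    (by
      apply MulOpposite.unop_injective
      simp [← mul_assoc, h_inv_mul_x])
    (by
      apply MulOpposite.unop_injective
      simpa using (commute_inv n m q ω).eq.symm)
    (by
      apply MulOpposite.unop_injective
      simp [mul_assoc, (commute_inv n m q ω).eq]
      simp [← mul_assoc, x_mul_g_inv])

theorem antipodeHom_g [NeZero n] [NeZero m] :
    antipodeHom n m q ω (g n m q ω) = MulOpposite.op (g n m q ω ^ (n - 1)) := by
  rw [antipodeHom, lift_g]

theorem antipodeHom_h [NeZero n] [NeZero m] :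
    antipodeHom n m q ω (h n m q ω) = MulOpposite.op (h n m q ω ^ (m - 1)) := by
  rw [antipodeHom, lift_h]

theorem antipodeHom_x [NeZero n] [NeZero m] : antipodeHom n m q ω (x n m q ω) =
    MulOpposite.op (-(x n m q ω * h n m q ω ^ (m - 1))) := by
  rw [antipodeHom, lift_x]

/-- The antipode as a linear endomorphism. -/
def antipodeLin [NeZero n] [NeZero m] : TaftT n m q ω →ₗ[K] TaftT n m q ω :=
  (MulOpposite.opLinearEquiv K).symm.toLinearMap ∘ₗ (antipodeHom n m q ω).toLinearMap

theorem antipodeLin_apply [NeZero n] [NeZero m] (a : TaftT n m q ω) :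
    antipodeLin n m q ω a = (antipodeHom n m q ω a).unop := rfl

theorem antipodeLin_mul [NeZero n] [NeZero m] (a b : TaftT n m q ω) :
    antipodeLin n m q ω (a * b) = antipodeLin n m q ω b * antipodeLin n m q ω a := by
  simp [antipodeLin_apply]

end hopf

section antipode

variable {K A : Type*} [Field K] [Ring A] [Algebra K A] (S : A →ₗ[K] A)

theorem rTensor_mul_of_anti (hS : ∀ a b, S (a * b) = S b * S a) {c : K} {u : A ⊗[K] A}
    (hu : LinearMap.mul' K A (S.rTensor A u) = algebraMap K A c) (v : A ⊗[K] A) :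
    LinearMap.mul' K A (S.rTensor A (u * v)) = c • LinearMap.mul' K A (S.rTensor A v) := by
  induction v using TensorProduct.induction_on with
  | zero => simp
  | add v w hv hw => simp [mul_add, hv, hw]
  | tmul b b' =>
    have key : ∀ u : A ⊗[K] A, LinearMap.mul' K A (S.rTensor A (u * b ⊗ₜ[K] b')) =
        S b * LinearMap.mul' K A (S.rTensor A u) * b' := by
      intro u
      induction u using TensorProduct.induction_on with
      | zero => simp
      | add v w hv hw => simp [mul_add, add_mul, hv, hw]
      | tmul a a' => simp [hS, mul_assoc]
    rw [key, hu, ← Algebra.commutes, mul_assoc, ← Algebra.smul_def]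
    simp

theorem lTensor_mul_of_anti (hS : ∀ a b, S (a * b) = S b * S a) {c : K} {v : A ⊗[K] A}
    (hv : LinearMap.mul' K A (S.lTensor A v) = algebraMap K A c) (u : A ⊗[K] A) :
    LinearMap.mul' K A (S.lTensor A (u * v)) = c • LinearMap.mul' K A (S.lTensor A u) := by
  induction u using TensorProduct.induction_on with
  | zero => simp
  | add v w hv hw => simp [add_mul, hv, hw]
  | tmul b b' =>
    have key : ∀ v : A ⊗[K] A, LinearMap.mul' K A (S.lTensor A (b ⊗ₜ[K] b' * v)) =
        b * LinearMap.mul' K A (S.lTensor A v) * S b' := by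
      intro v
      induction v using TensorProduct.induction_on with
      | zero => simp
      | add v w hv hw => simp [mul_add, add_mul, hv, hw]
      | tmul a a' => simp [hS, mul_assoc]
    rw [key, hv, ← Algebra.commutes, mul_assoc, ← Algebra.smul_def]
    simp

end antipode

section hopfInstance

variable {K : Type*} [Field K] (n m : ℕ) (q ω : K)
  [NeZero n] [NeZero m] [Fact (IsPrimitiveRoot q m)]

theorem antipode_left (a : TaftT n m q ω) :
    LinearMap.mul' K _ ((antipodeLin n m q ω).rTensor _ (comulHom n m q ω a)) =
      algebraMap K _ (counitHom n m q ω a) := by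
  induction a using TaftT.induction with
  | hK r => simp [Algebra.algebraMap_eq_smul_one, Algebra.TensorProduct.one_def,
      antipodeLin_apply]
  | hg => simp [comulHom_g, counitHom_g, antipodeLin_apply, antipodeHom_g, g_inv]
  | hh => simp [comulHom_h, counitHom_h, antipodeLin_apply, antipodeHom_h, h_inv]
  | hx => simp [comulHom_x, counitHom_x, antipodeLin_apply, antipodeHom_x, mul_assoc, h_inv]
  | hmul a b ha hb =>
    rw [map_mul, rTensor_mul_of_anti _ (antipodeLin_mul n m q ω) ha, hb, map_mul, map_mul,
      Algebra.smul_def]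
  | hadd a b ha hb => simp [ha, hb]

theorem antipode_right (a : TaftT n m q ω) :
    LinearMap.mul' K _ ((antipodeLin n m q ω).lTensor _ (comulHom n m q ω a)) =
      algebraMap K _ (counitHom n m q ω a) := by
  induction a using TaftT.induction with
  | hK r => simp [Algebra.algebraMap_eq_smul_one, Algebra.TensorProduct.one_def,
      antipodeLin_apply]
  | hg => simp [comulHom_g, counitHom_g, antipodeLin_apply, antipodeHom_g, g_inv']
  | hh => simp [comulHom_h, counitHom_h, antipodeLin_apply, antipodeHom_h, h_inv']
  | hx => simp [comulHom_x, counitHom_x, antipodeLin_apply, antipodeHom_x, antipodeHom_h]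
  | hmul a b ha hb =>
    rw [map_mul, lTensor_mul_of_anti _ (antipodeLin_mul n m q ω) hb, ha, map_mul, map_mul,
      Algebra.smul_def, Algebra.commutes]
  | hadd a b ha hb => simp [ha, hb]

/-- The Hopf algebra structure on `T_{nm²}^ω(q)`. -/
instance : HopfAlgebra K (TaftT n m q ω) where
  antipode := antipodeLin n m q ω
  mul_antipode_rTensor_comul := LinearMap.ext (antipode_left n m q ω)
  mul_antipode_lTensor_comul := LinearMap.ext (antipode_right n m q ω)

end hopfInstance

end

end TaftT

/-- Two Hopf algebras are isomorphic if there is a bijective algebra and coalgebra map between them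
that commutes with the antipodes. -/
def HopfIsomorphic (K A B : Type*) [Field K] [Ring A] [Ring B] [HopfAlgebra K A]
    [HopfAlgebra K B] : Prop :=
  ∃ e : A ≃ₐc[K] B, ∀ a : A, e (HopfAlgebra.antipode K a) = HopfAlgebra.antipode K (e a)

/-! Modulo `x ^ 2`, the algebra `TaftT n m q ω` acts by upper triangular `2 × 2` matrices over the
group algebra of `C_n × C_m`: the diagonal comes from the quotient by `x`, the corner `δ` is a skew
derivation with `δ x = 1`. Comparing the comultiplication with its opposite through `π ⊗ δ`, `π` the
quotient map, gives `δ w = 0` for group-like `w` and `π v = h` whenever `Δ y = y ⊗ v + 1 ⊗ y` with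
`δ y ≠ 0`. An isomorphism `e` maps `x` to such a `y`, since otherwise `δ ∘ e`, a skew derivation
vanishing on generators, would be zero. So `π (e h) = h` and `π (e g) = g ^ s * h ^ l`; applying
`δ ∘ e` to `g * x = ω • (x * g)` then yields `ω' ^ s = q ^ l * ω`, and surjectivity forces `s` to
be prime to `n`. Conversely, `g ↦ g ^ s * h ^ l`, `h ↦ h`, `x ↦ x` is an isomorphism. -/

section GeneralLemmas

theorem eq_of_tmul_eq_tmul {K V W : Type*} [Field K] [AddCommGroup V] [Module K V]
    [AddCommGroup W] [Module K W] {a b : V} {z : W} (hz : z ≠ 0)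
    (h : a ⊗ₜ[K] z = b ⊗ₜ[K] z) : a = b := by
  obtain ⟨f, hf⟩ : ∃ f : Module.Dual K W, f z ≠ 0 := by
    by_contra! hf
    exact hz ((Module.forall_dual_apply_eq_zero_iff K z).mp hf)
  have hfz : f z • a = f z • b := by
    simpa using congrArg (TensorProduct.rid K V ∘ f.lTensor V) h
  exact smul_right_injective V hf hfz

theorem zpow_mul_sub_eq_iff {G₀ : Type*} [CommGroupWithZero G₀] {a : G₀} (ha : a ≠ 0) (b : G₀)
    (s t t' : ℕ) : a ^ ((s : ℤ) * t' - t) = b ↔ (a ^ t') ^ s = b * a ^ t := by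
  rw [zpow_sub₀ ha, div_eq_iff (zpow_ne_zero _ ha), ← Nat.cast_mul, zpow_natCast, zpow_natCast,
    mul_comm s, pow_mul]

open WithConv in
/-- Both sides are convolution inverses of `f`. -/
theorem map_antipode {R A B : Type*} [CommSemiring R] [Semiring A] [Semiring B] [HopfAlgebra R A]
    [HopfAlgebra R B] (f : A →ₐc[R] B) (a : A) :
    f (HopfAlgebra.antipode R a) = HopfAlgebra.antipode R (f a) := by
  let F : A →ₗ[R] B := (f : A →ₐ[R] B).toLinearMap
  have left_inv : toConv (F ∘ₗ HopfAlgebra.antipode R) * toConv F = 1 := by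
    have h := LinearMap.algHom_comp_convMul_distrib (f : A →ₐ[R] B)
      (toConv (HopfAlgebra.antipode R)) (toConv LinearMap.id)
    rw [LinearMap.antipode_mul_id] at h
    ext a
    exact (LinearMap.congr_fun h a).symm.trans (AlgHomClass.commutes f _)
  have right_inv : toConv F * toConv (HopfAlgebra.antipode R ∘ₗ F) = 1 := by
    have h := LinearMap.convMul_comp_coalgHom_distrib
      (toConv LinearMap.id) (toConv (HopfAlgebra.antipode R)) (f : A →ₗc[R] B)
    rw [LinearMap.id_mul_antipode] at h
    ext a
    exact (LinearMap.congr_fun h a).symm.trans (by simp)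
  exact LinearMap.congr_fun (congrArg ofConv (left_inv_eq_right_inv left_inv right_inv)) a

theorem hopfIsomorphic_iff_nonempty_bialgEquiv {K A B : Type*} [Field K] [Ring A] [Ring B]
    [HopfAlgebra K A] [HopfAlgebra K B] : HopfIsomorphic K A B ↔ Nonempty (A ≃ₐc[K] B) :=
  ⟨fun ⟨e, _⟩ ↦ ⟨e⟩, fun ⟨e⟩ ↦ ⟨e, map_antipode (e : A →ₐc[K] B)⟩⟩

end GeneralLemmas

section SkewDerivation

variable {R A B : Type*} [CommSemiring R] [Semiring A] [Algebra R A] [Semiring B] [Algebra R B]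

/-- A linear map `δ : A → B` is an `(α, β)`-skew derivation if
`δ (a * b) = α a * δ b + δ a * β b`; equivalently `a ↦ !![α a, δ a; 0, β a]` is multiplicative. -/
def IsSkewDerivation (α β : A →ₐ[R] B) (δ : A →ₗ[R] B) : Prop :=
  ∀ a b, δ (a * b) = α a * δ b + δ a * β b

namespace IsSkewDerivation

theorem map_one {B : Type*} [Ring B] [Algebra R B] {α β : A →ₐ[R] B} {δ : A →ₗ[R] B}
    (hδ : IsSkewDerivation α β δ) : δ 1 = 0 := by
  simpa using hδ 1 1

theorem comp {C : Type*} [Semiring C] [Algebra R C] {α β : A →ₐ[R] B} {δ : A →ₗ[R] B}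
    (hδ : IsSkewDerivation α β δ) (φ : C →ₐ[R] A) :
    IsSkewDerivation (α.comp φ) (β.comp φ) (δ ∘ₗ φ.toLinearMap) := fun a b ↦ by
  simp [hδ (φ a) (φ b)]

theorem mulLeft_comp {B : Type*} [CommSemiring B] [Algebra R B] {α β : A →ₐ[R] B} {δ : A →ₗ[R] B}
    (hδ : IsSkewDerivation α β δ) (c : B) :
    IsSkewDerivation α β (LinearMap.mulLeft R c ∘ₗ δ) := fun a b ↦ by
  simp only [LinearMap.comp_apply, LinearMap.mulLeft_apply, hδ a b]
  ring

theorem map_tensor {A' B' : Type*} [Semiring A'] [Algebra R A'] [Semiring B'] [Algebra R B']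
    {α β : A →ₐ[R] B} {δ : A →ₗ[R] B} (hδ : IsSkewDerivation α β δ) (f : A' →ₐ[R] B') :
    IsSkewDerivation (Algebra.TensorProduct.map f α) (Algebra.TensorProduct.map f β)
      (TensorProduct.map f.toLinearMap δ) := fun u v ↦ by
  induction u using TensorProduct.induction_on with
  | zero => simp
  | add u u' hu hu' => simp only [add_mul, map_add, hu, hu']; abel
  | tmul a a' =>
    induction v using TensorProduct.induction_on with
    | zero => simp
    | add v v' hv hv' => simp only [mul_add, map_add, hv, hv']; abel
    | tmul b b' => simp [hδ a' b', TensorProduct.tmul_add]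

end IsSkewDerivation

end SkewDerivation

section CharacterTwist

variable {R G : Type*} [CommSemiring R] [Monoid G]

/-- The endomorphism of a monoid algebra that rescales each basis element by a character. -/
noncomputable def characterTwist (χ : G →* R) : MonoidAlgebra R G →ₐ[R] MonoidAlgebra R G :=
  MonoidAlgebra.lift R _ _
    { toFun u := χ u • MonoidAlgebra.of R G u
      map_one' := by simp [MonoidAlgebra.one_def]
      map_mul' u v := by simp }

theorem characterTwist_of (χ : G →* R) (u : G) :
    characterTwist χ (MonoidAlgebra.of R G u) = χ u • MonoidAlgebra.of R G u := by
  simp [characterTwist]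

end CharacterTwist

namespace TaftT

noncomputable section

section Presentation

variable {K : Type*} [Field K] {n m : ℕ} {q ω : K}

theorem skewDerivation_ext {B : Type*} [Ring B] [Algebra K B] {α β : TaftT n m q ω →ₐ[K] B}
    {δ δ' : TaftT n m q ω →ₗ[K] B} (hδ : IsSkewDerivation α β δ) (hδ' : IsSkewDerivation α β δ')
    (hg : δ (g n m q ω) = δ' (g n m q ω)) (hh : δ (h n m q ω) = δ' (h n m q ω))
    (hx : δ (x n m q ω) = δ' (x n m q ω)) : δ = δ' := by
  ext a
  induction a using TaftT.induction with
  | hK r => simp [Algebra.algebraMap_eq_smul_one, hδ.map_one, hδ'.map_one]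
  | hg => exact hg
  | hh => exact hh
  | hx => exact hx
  | hmul a b ha hb => rw [hδ, hδ', ha, hb]
  | hadd a b ha hb => rw [map_add, map_add, ha, hb]

theorem g_pow_mul_x (s : ℕ) : g n m q ω ^ s * x n m q ω = ω ^ s • (x n m q ω * g n m q ω ^ s) := by
  induction s with
  | zero => simp
  | succ s ih =>
    rw [pow_succ, mul_assoc, g_mul_x, mul_smul_comm, ← mul_assoc, ih, smul_mul_assoc, smul_smul,
      mul_assoc, pow_succ']

theorem h_pow_eq_one_of_pow_eq_one (hq : IsPrimitiveRoot q m) {k : ℕ} (hk : q ^ k = 1) :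
    h n m q ω ^ k = 1 := by
  obtain ⟨j, rfl⟩ := hq.dvd_of_pow_eq_one k hk
  rw [pow_mul, h_pow, one_pow]

end Presentation

section Coalgebra

open Coalgebra

variable {K : Type*} [Field K] {n m : ℕ} [NeZero m] {q ω : K} [Fact (IsPrimitiveRoot q m)]

theorem comul_g : comul (R := K) (g n m q ω) = g n m q ω ⊗ₜ g n m q ω := comulHom_g n m q ω

theorem comul_h : comul (R := K) (h n m q ω) = h n m q ω ⊗ₜ h n m q ω := comulHom_h n m q ω

theorem comul_x : comul (R := K) (x n m q ω) = x n m q ω ⊗ₜ h n m q ω + 1 ⊗ₜ x n m q ω :=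
  comulHom_x n m q ω

theorem counit_g : counit (R := K) (g n m q ω) = 1 := counitHom_g n m q ω

theorem counit_h : counit (R := K) (h n m q ω) = 1 := counitHom_h n m q ω

theorem counit_x : counit (R := K) (x n m q ω) = 0 := counitHom_x n m q ω

theorem isGroupLikeElem_g : IsGroupLikeElem K (g n m q ω) := ⟨counit_g, comul_g⟩

theorem isGroupLikeElem_h : IsGroupLikeElem K (h n m q ω) := ⟨counit_h, comul_h⟩

theorem comul_map_x {C : Type*} [Semiring C] [Bialgebra K C] (f : TaftT n m q ω →ₐc[K] C) :
    comul (R := K) (f (x n m q ω)) = f (x n m q ω) ⊗ₜ f (h n m q ω) + 1 ⊗ₜ f (x n m q ω) := by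
  rw [← CoalgHomClass.map_comp_comul_apply, comul_x]
  simp

/-- Algebra maps killing `x` only see the cocommutative quotient by `x`. -/
theorem map_comp_comm_comp_comul {B B' : Type*} [Semiring B] [Algebra K B] [Semiring B']
    [Algebra K B'] {f : TaftT n m q ω →ₐ[K] B} {f' : TaftT n m q ω →ₐ[K] B'}
    (hf : f (x n m q ω) = 0) (hf' : f' (x n m q ω) = 0) :
    (Algebra.TensorProduct.map f f').comp ((Algebra.TensorProduct.comm K _ _).toAlgHom.comp
      (Bialgebra.comulAlgHom K _)) =
    (Algebra.TensorProduct.map f f').comp (Bialgebra.comulAlgHom K _) :=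
  algHom_ext (by simp [comul_g]) (by simp [comul_h]) (by simp [comul_x, hf, hf'])

end Coalgebra

section GroupAlgebra

/-- The algebra of the group `C_n × C_m` of monomials `g ^ i * h ^ j`; it is the quotient of
`TaftT n m q ω` by `x`. -/
abbrev GroupAlg (K : Type*) [Field K] (n m : ℕ) : Type _ :=
  MonoidAlgebra K (Multiplicative (ZMod n) × Multiplicative (ZMod m))

variable (K : Type*) [Field K] (n m : ℕ)

/-- The class of `g` in the group algebra. -/
def gBar : GroupAlg K n m := MonoidAlgebra.of K _ (.ofAdd 1, 1)

/-- The class of `h` in the group algebra. -/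
def hBar : GroupAlg K n m := MonoidAlgebra.of K _ (1, .ofAdd 1)

variable {K n m}

theorem gBar_pow_mul_hBar_pow (i j : ℕ) : gBar K n m ^ i * hBar K n m ^ j =
    MonoidAlgebra.of K _ (.ofAdd (i : ZMod n), .ofAdd (j : ZMod m)) := by
  rw [gBar, hBar, ← map_pow, ← map_pow, ← map_mul]
  simp [← ofAdd_nsmul]

variable (K n m)

theorem gBar_pow : gBar K n m ^ n = 1 := by
  simpa [← Prod.one_eq_mk, ← MonoidAlgebra.one_def] using
    gBar_pow_mul_hBar_pow (K := K) (n := n) (m := m) n 0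

theorem hBar_pow : hBar K n m ^ m = 1 := by
  simpa [← Prod.one_eq_mk, ← MonoidAlgebra.one_def] using
    gBar_pow_mul_hBar_pow (K := K) (n := n) (m := m) 0 m

theorem isUnit_hBar [NeZero m] : IsUnit (hBar K n m) :=
  .of_pow_eq_one (hBar_pow K n m) (NeZero.ne m)

theorem isUnit_gBar_pow_mul_hBar_pow [NeZero n] [NeZero m] (i j : ℕ) :
    IsUnit (gBar K n m ^ i * hBar K n m ^ j) :=
  ((IsUnit.of_pow_eq_one (gBar_pow K n m) (NeZero.ne n)).pow i).mul ((isUnit_hBar K n m).pow j)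

theorem hBar_ne_one (hm : 1 < m) : hBar K n m ≠ 1 := by
  have : Fact (1 < m) := ⟨hm⟩
  rw [hBar, ← map_one (MonoidAlgebra.of K _), MonoidAlgebra.of_injective.ne_iff]
  simp

end GroupAlgebra

section Projection

variable {K : Type*} [Field K] (n m : ℕ) [NeZero m] (q ω : K)

/-- The quotient map by `x`. -/
def proj : TaftT n m q ω →ₐ[K] GroupAlg K n m :=
  lift (gBar K n m) (hBar K n m) 0 (gBar_pow K n m) (hBar_pow K n m) (by simp [NeZero.ne m])
    (by simp) (mul_comm _ _) (by simp)

variable {n m q ω}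

theorem proj_g : proj n m q ω (g n m q ω) = gBar K n m := lift_g ..

theorem proj_h : proj n m q ω (h n m q ω) = hBar K n m := lift_h ..

theorem proj_x : proj n m q ω (x n m q ω) = 0 := lift_x ..

variable [Fact (IsPrimitiveRoot q m)]

variable (n m q ω) in
/-- The quotient map by `x` as a map of bialgebras. -/
def projBialgHom : TaftT n m q ω →ₐc[K] GroupAlg K n m :=
  .ofAlgHom (proj n m q ω)
    (algHom_ext (by simp [counit_g, proj_g, gBar]) (by simp [counit_h, proj_h, hBar])
      (by simp [counit_x, proj_x]))
    (algHom_ext (by simp [comul_g, proj_g, gBar]) (by simp [comul_h, proj_h, hBar])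
      (by simp [comul_x, proj_x]))

theorem exists_proj_eq [NeZero n] {w : TaftT n m q ω} (hw : IsGroupLikeElem K w) :
    ∃ s < n, ∃ l < m, proj n m q ω w = gBar K n m ^ s * hBar K n m ^ l := by
  obtain ⟨⟨a, b⟩, hab⟩ :=
    MonoidAlgebra.isGroupLikeElem_iff_mem_range_of.mp (hw.map (projBialgHom n m q ω))
  refine ⟨a.toAdd.val, ZMod.val_lt _, b.toAdd.val, ZMod.val_lt _, hab.symm.trans ?_⟩
  simp [gBar_pow_mul_hBar_pow]

end Projection

section Twist

variable {K : Type*} [Field K] {n m : ℕ} [NeZero n] [NeZero m] {q ω : K}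

/-- The endomorphism `σ` of the group algebra for which `u * x = x * σ u` in `TaftT n m q ω`. -/
def twist (hω : ω ^ n = 1) (hq : q ^ m = 1) : GroupAlg K n m →ₐ[K] GroupAlg K n m :=
  characterTwist ((AddChar.zmodChar n hω).toMonoidHom.coprod
    (AddChar.zmodChar m (inv_pow q m ▸ inv_eq_one.mpr hq)).toMonoidHom)

theorem twist_gBar_pow_mul_hBar_pow (hω : ω ^ n = 1) (hq : q ^ m = 1) (i j : ℕ) :
    twist hω hq (gBar K n m ^ i * hBar K n m ^ j) =
      (ω ^ i * q⁻¹ ^ j) • (gBar K n m ^ i * hBar K n m ^ j) := by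
  rw [gBar_pow_mul_hBar_pow, twist, characterTwist_of]
  simp [AddChar.zmodChar_apply']

theorem twist_gBar (hω : ω ^ n = 1) (hq : q ^ m = 1) :
    twist hω hq (gBar K n m) = ω • gBar K n m := by
  simpa using twist_gBar_pow_mul_hBar_pow hω hq 1 0

theorem twist_hBar (hω : ω ^ n = 1) (hq : q ^ m = 1) :
    twist hω hq (hBar K n m) = q⁻¹ • hBar K n m := by
  simpa using twist_gBar_pow_mul_hBar_pow hω hq 0 1

end Twist

section DegreeOne

variable {K : Type*} [Field K] {n m : ℕ} [NeZero m] {q ω : K}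
  (hm : 1 < m) (hω : ω ^ n = 1) (hq : q ^ m = 1)

/-- The upper triangular representation over the group algebra with `x` acting as `E₁₂`. -/
def triangularRep : TaftT n m q ω →ₐ[K] Matrix (Fin 2) (Fin 2) (GroupAlg K n m) :=
  lift (Matrix.diagonal ![ω • gBar K n m, gBar K n m])
    (Matrix.diagonal ![q⁻¹ • hBar K n m, hBar K n m]) !![0, 1; 0, 0]
    (by
      rw [Matrix.diagonal_pow, Matrix.diagonal_eq_one, funext_iff, Fin.forall_fin_two]
      simp [smul_pow, hω, gBar_pow])
    (by
      rw [Matrix.diagonal_pow, Matrix.diagonal_eq_one, funext_iff, Fin.forall_fin_two]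
      simp [smul_pow, hq, hBar_pow])
    (pow_eq_zero_of_le hm (by simp [pow_two, ← Matrix.ext_iff, Fin.forall_fin_two]))
    (by
      have hq0 : q ≠ 0 := by rintro rfl; simp [NeZero.ne m] at hq
      simp [Matrix.diagonal_fin_two, smul_smul, hq0, funext_iff])
    (by simp [Matrix.diagonal_mul_diagonal, mul_comm])
    (by simp [Matrix.diagonal_fin_two])

/-- The coefficient of `x`, an entry of `triangularRep`. -/
def degOne : TaftT n m q ω →ₗ[K] GroupAlg K n m :=
  Matrix.entryLinearMap K (GroupAlg K n m) 0 1 ∘ₗ (triangularRep hm hω hq).toLinearMap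

theorem degOne_g : degOne hm hω hq (g n m q ω) = 0 := by simp [degOne, triangularRep, lift_g]

theorem degOne_h : degOne hm hω hq (h n m q ω) = 0 := by simp [degOne, triangularRep, lift_h]

theorem degOne_x : degOne hm hω hq (x n m q ω) = 1 := by simp [degOne, triangularRep, lift_x]

variable [NeZero n]

theorem triangularRep_apply (a : TaftT n m q ω) : triangularRep hm hω hq a =
    !![twist hω hq (proj n m q ω a), degOne hm hω hq a; 0, proj n m q ω a] := by
  suffices triangularRep hm hω hq a 0 0 = twist hω hq (proj n m q ω a) ∧
      triangularRep hm hω hq a 1 0 = 0 ∧ triangularRep hm hω hq a 1 1 = proj n m q ω a by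
    obtain ⟨h00, h10, h11⟩ := this
    rw [← h00, ← h10, ← h11]
    exact Matrix.eta_fin_two _
  induction a using TaftT.induction with
  | hK r =>
    simp only [AlgHom.commutes]
    simp [Matrix.algebraMap_eq_diagonal]
  | hg => simp [triangularRep, lift_g, proj_g, twist_gBar]
  | hh => simp [triangularRep, lift_h, proj_h, twist_hBar]
  | hx => simp [triangularRep, lift_x, proj_x]
  | hmul a b ha hb => simp [Matrix.mul_apply, ha, hb]
  | hadd a b ha hb => simp [ha, hb]

theorem isSkewDerivation_degOne : IsSkewDerivation ((twist hω hq).comp (proj n m q ω))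
    (proj n m q ω) (degOne hm hω hq) := fun a b ↦ by
  simpa [triangularRep_apply] using congr($(map_mul (triangularRep hm hω hq) a b) 0 1)

end DegreeOne

section SkewPrimitive

open Coalgebra

variable {K : Type*} [Field K] {n m : ℕ} [NeZero n] [NeZero m] {q ω : K}
  [Fact (IsPrimitiveRoot q m)] (hm : 1 < m) (hω : ω ^ n = 1) (hq : q ^ m = 1)

/-- In degree `(0, 1)` the opposite coproduct of `x` is `h ⊗ x`, where the coproduct is `1 ⊗ x`. -/
theorem map_proj_degOne_comm_comul (a : TaftT n m q ω) :
    TensorProduct.map (proj n m q ω).toLinearMap (degOne hm hω hq)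
      (TensorProduct.comm K _ _ (comul a)) =
    (hBar K n m ⊗ₜ[K] 1) *
      TensorProduct.map (proj n m q ω).toLinearMap (degOne hm hω hq) (comul a) := by
  let Δ := Bialgebra.comulAlgHom K (TaftT n m q ω)
  have hδ := (isSkewDerivation_degOne hm hω hq).map_tensor (proj n m q ω)
  have left := hδ.comp ((Algebra.TensorProduct.comm K _ _).toAlgHom.comp Δ)
  have right := (hδ.comp Δ).mulLeft_comp (hBar K n m ⊗ₜ[K] 1)
  rw [map_comp_comm_comp_comul proj_x (by simp [proj_x]), map_comp_comm_comp_comul proj_x proj_x]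
    at left
  have h1 := (isSkewDerivation_degOne hm hω hq).map_one
  refine LinearMap.congr_fun (skewDerivation_ext left right ?_ ?_ ?_) a
  · simp [Δ, comul_g, degOne_g]
  · simp [Δ, comul_h, degOne_h]
  · simp [Δ, comul_x, proj_x, proj_h, degOne_h, degOne_x, h1]

theorem degOne_eq_zero {w : TaftT n m q ω} (hw : IsGroupLikeElem K w) :
    degOne hm hω hq w = 0 := by
  obtain ⟨s, -, l, -, hsl⟩ := exists_proj_eq hw
  have hcomm := map_proj_degOne_comm_comul hm hω hq w
  simp only [hw.comul_eq_tmul_self, TensorProduct.comm_tmul, TensorProduct.map_tmul,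
    AlgHom.toLinearMap_apply, Algebra.TensorProduct.tmul_mul_tmul, one_mul] at hcomm
  by_contra h0
  have hp : proj n m q ω w = hBar K n m * proj n m q ω w := eq_of_tmul_eq_tmul h0 hcomm
  rw [hsl] at hp
  exact hBar_ne_one K n m hm ((isUnit_gBar_pow_mul_hBar_pow K n m s l).mul_eq_right.mp hp.symm)

theorem proj_eq_hBar {v y : TaftT n m q ω} (hv : IsGroupLikeElem K v)
    (hy : comul (R := K) y = y ⊗ₜ[K] v + 1 ⊗ₜ[K] y) (hy0 : degOne hm hω hq y ≠ 0) :
    proj n m q ω v = hBar K n m := by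
  have h1 := (isSkewDerivation_degOne hm hω hq).map_one
  have hcomm := map_proj_degOne_comm_comul hm hω hq y
  simp only [hy, map_add, TensorProduct.comm_tmul, TensorProduct.map_tmul,
    AlgHom.toLinearMap_apply, degOne_eq_zero hm hω hq hv, h1, TensorProduct.tmul_zero,
    add_zero, zero_add, map_one, Algebra.TensorProduct.tmul_mul_tmul, one_mul, mul_one] at hcomm
  exact eq_of_tmul_eq_tmul hy0 hcomm

end SkewPrimitive

section Isomorphism

variable {K : Type*} [Field K] {n m : ℕ} [NeZero n] [NeZero m] {q ω ω' : K}
  [hq : Fact (IsPrimitiveRoot q m)] (hm : 1 < m) (hω' : ω' ^ n = 1)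
  (e : TaftT n m q ω ≃ₐc[K] TaftT n m q ω')

include hm hω' e

theorem degOne_map_x_ne_zero : degOne hm hω' hq.out.pow_eq_one (e (x n m q ω)) ≠ 0 := by
  intro hx
  let D := degOne hm hω' hq.out.pow_eq_one
  let E : TaftT n m q ω →ₐ[K] TaftT n m q ω' := e
  have hD : D ∘ₗ E.toLinearMap = 0 :=
    skewDerivation_ext ((isSkewDerivation_degOne hm hω' hq.out.pow_eq_one).comp E)
      (fun _ _ ↦ by simp)
      (degOne_eq_zero hm hω' _ (isGroupLikeElem_g.map e))
      (degOne_eq_zero hm hω' _ (isGroupLikeElem_h.map e)) hx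
  have h10 : D (e (e.symm (x n m q ω'))) = 0 := LinearMap.congr_fun hD _
  rw [BialgEquiv.apply_symm_apply, degOne_x] at h10
  exact one_ne_zero h10

theorem proj_map_h : proj n m q ω' (e (h n m q ω)) = hBar K n m :=
  proj_eq_hBar hm hω' hq.out.pow_eq_one (isGroupLikeElem_h.map e)
    (comul_map_x (e : TaftT n m q ω →ₐc[K] TaftT n m q ω')) (degOne_map_x_ne_zero hm hω' e)

theorem proj_map_x : proj n m q ω' (e (x n m q ω)) = 0 := by
  let y := proj n m q ω' (e (x n m q ω))
  have hxh : y * hBar K n m = q • (hBar K n m * y) := by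
    simpa [y, proj_map_h hm hω'] using congr(proj n m q ω' (e $(x_mul_h n m q ω)))
  have hzero : (1 - q) • (hBar K n m * y) = 0 := by
    rw [sub_smul, one_smul, ← hxh, mul_comm, sub_self]
  have hq1 : 1 - q ≠ 0 := sub_ne_zero.mpr (hq.out.ne_one hm).symm
  exact (isUnit_hBar K n m).mul_right_eq_zero.mp ((smul_eq_zero.mp hzero).resolve_left hq1)

theorem pow_eq_of_proj_map_g {s l : ℕ}
    (hsl : proj n m q ω' (e (g n m q ω)) = gBar K n m ^ s * hBar K n m ^ l) :
    ω' ^ s = q ^ l * ω := by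
  let u := gBar K n m ^ s * hBar K n m ^ l
  let d := degOne hm hω' hq.out.pow_eq_one (e (x n m q ω))
  have hgx : (ω' ^ s * q⁻¹ ^ l) • (u * d) = ω • (u * d) := by
    have h1 := congr(degOne hm hω' hq.out.pow_eq_one (e $(g_mul_x n m q ω)))
    rw [map_mul, isSkewDerivation_degOne, map_smul, map_smul, map_mul, isSkewDerivation_degOne,
      degOne_eq_zero hm hω' _ (isGroupLikeElem_g.map e), AlgHom.comp_apply, AlgHom.comp_apply, hsl,
      twist_gBar_pow_mul_hBar_pow, zero_mul, add_zero, mul_zero, zero_add] at h1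
    rwa [smul_mul_assoc, mul_comm d] at h1
  have hud : u * d ≠ 0 := fun h0 ↦ degOne_map_x_ne_zero hm hω' e
    ((isUnit_gBar_pow_mul_hBar_pow K n m s l).mul_right_eq_zero.mp h0)
  have hω : ω' ^ s * q⁻¹ ^ l = ω := smul_left_injective K hud hgx
  have hq0 : q ≠ 0 := hq.out.ne_zero (NeZero.ne m)
  rw [← hω, mul_left_comm, ← mul_pow, mul_inv_cancel₀ hq0, one_pow, mul_one]

/-- On the quotient `K[C_n]` by `x` and `h - 1`, the isomorphism `e` acts by `c ↦ c ^ s`. -/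
theorem coprime_of_proj_map_g {s l : ℕ}
    (hsl : proj n m q ω' (e (g n m q ω)) = gBar K n m ^ s * hBar K n m ^ l) : s.Coprime n := by
  let π : GroupAlg K n m →ₐ[K] MonoidAlgebra K (Multiplicative (ZMod n)) :=
    MonoidAlgebra.mapDomainAlgHom K K (MonoidHom.fst _ _)
  have hπ (i j : ℕ) : π (gBar K n m ^ i * hBar K n m ^ j) =
      MonoidAlgebra.of K _ (.ofAdd (i : ZMod n)) := by
    simp [π, gBar_pow_mul_hBar_pow]
  have hπg : π (gBar K n m) = MonoidAlgebra.of K _ (.ofAdd 1) := by simp [π, gBar]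
  let P : TaftT n m q ω →ₐ[K] MonoidAlgebra K (Multiplicative (ZMod n)) := π.comp (proj n m q ω)
  let P' : TaftT n m q ω' →ₐ[K] MonoidAlgebra K (Multiplicative (ZMod n)) := π.comp (proj n m q ω')
  have hpow : P'.comp (e : _ →ₐ[K] _) =
      (MonoidAlgebra.mapDomainAlgHom K K (powMonoidHom s)).comp P := by
    apply algHom_ext
    · simp [P, P', π, hsl, proj_g, gBar, hBar]
    · simp [P, P', π, proj_map_h hm hω' e, proj_h, hBar]
    · simp [P, P', proj_x, proj_map_x hm hω']
  obtain ⟨a, -, b, -, hab⟩ := exists_proj_eq ((isGroupLikeElem_g (ω := ω')).map e.symm)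
  have hgs : MonoidAlgebra.of K _ (Multiplicative.ofAdd (1 : ZMod n)) =
      MonoidAlgebra.of K _ (Multiplicative.ofAdd (s * a : ZMod n)) := by
    rw [← nsmul_eq_mul, ofAdd_nsmul]
    simpa [P, P', hab, hπ, hπg, proj_g] using AlgHom.congr_fun hpow (e.symm (g n m q ω'))
  have h1 : (1 : ZMod n) = s * a :=
    Multiplicative.ofAdd.injective (MonoidAlgebra.of_injective hgs)
  exact (ZMod.isUnit_iff_coprime s n).mp (.of_mul_eq_one _ h1.symm)

theorem exists_pow_eq_of_bialgEquiv : ∃ l < m, ∃ s < n, s.Coprime n ∧ ω' ^ s = q ^ l * ω := by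
  obtain ⟨s, hs, l, hl, hsl⟩ := exists_proj_eq (isGroupLikeElem_g.map e)
  exact ⟨l, hl, s, hs, coprime_of_proj_map_g hm hω' e hsl, pow_eq_of_proj_map_g hm hω' e hsl⟩

end Isomorphism

section MonomialHom

variable {K : Type*} [Field K] {n m : ℕ} {q ω ω' : K}

theorem g_pow_mul_h_pow_pow (s l k : ℕ) :
    (g n m q ω ^ s * h n m q ω ^ l) ^ k = g n m q ω ^ (s * k) * h n m q ω ^ (l * k) := by
  rw [Commute.mul_pow (Commute.pow_pow (h_mul_g n m q ω).symm s l), pow_mul, pow_mul]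

theorem g_pow_mul_h_pow_mul_x (s l : ℕ) :
    q ^ l • (g n m q ω ^ s * h n m q ω ^ l * x n m q ω) =
      ω ^ s • (x n m q ω * (g n m q ω ^ s * h n m q ω ^ l)) := by
  rw [mul_assoc, ← mul_smul_comm, ← QBinomial.mul_pow_of_skew (x_mul_h n m q ω), ← mul_assoc,
    g_pow_mul_x, smul_mul_assoc, mul_assoc]

variable [NeZero m] [hq : Fact (IsPrimitiveRoot q m)]

variable (m) in
/-- The bialgebra map with `g ↦ g ^ s * h ^ l`, `h ↦ h`, `x ↦ x`. -/
def monomialHom {s l : ℕ} (hl : (q ^ l) ^ n = 1) (hsl : ω' ^ s = q ^ l * ω) :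
    TaftT n m q ω →ₐc[K] TaftT n m q ω' :=
  let f : TaftT n m q ω →ₐ[K] TaftT n m q ω' :=
    lift (g n m q ω' ^ s * h n m q ω' ^ l) (h n m q ω') (x n m q ω')
      (by
        rw [g_pow_mul_h_pow_pow, h_pow_eq_one_of_pow_eq_one hq.out (pow_mul q l n ▸ hl), mul_comm s,
          pow_mul, g_pow, one_pow, one_mul])
      (h_pow n m q ω') (x_pow n m q ω') (x_mul_h n m q ω')
      (((show Commute _ _ from h_mul_g n m q ω').pow_right s).mul_right (.pow_right rfl l)).eq
      (by
        have hq0 : q ^ l ≠ 0 := pow_ne_zero l (hq.out.ne_zero (NeZero.ne m))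
        refine smul_right_injective _ hq0 ((g_pow_mul_h_pow_mul_x s l).trans ?_)
        rw [hsl, mul_smul])
  .ofAlgHom f
    (algHom_ext (by simp [f, lift_g, counit_g, counit_h]) (by simp [f, lift_h, counit_h])
      (by simp [f, lift_x, counit_x]))
    (algHom_ext (by simp [f, lift_g, comul_g, comul_h]) (by simp [f, lift_h, comul_h])
      (by simp [f, lift_x, lift_h, comul_x]))

section

variable {s l : ℕ} (hl : (q ^ l) ^ n = 1) (hsl : ω' ^ s = q ^ l * ω)

theorem monomialHom_g : monomialHom m hl hsl (g n m q ω) = g n m q ω' ^ s * h n m q ω' ^ l :=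
  lift_g ..

theorem monomialHom_h : monomialHom m hl hsl (h n m q ω) = h n m q ω' := lift_h ..

theorem monomialHom_x : monomialHom m hl hsl (x n m q ω) = x n m q ω' := lift_x ..

theorem monomialHom_comp {s' l' : ℕ} (hl' : (q ^ l') ^ n = 1) (hsl' : ω ^ s' = q ^ l' * ω')
    (hs : s' * s ≡ 1 [MOD n]) (hh : q ^ (l' * s + l) = 1) :
    (monomialHom m hl' hsl').comp (monomialHom m hl hsl) =
      BialgHom.id K (TaftT n m q ω) := by
  apply BialgHom.coe_toAlgHom_injective
  apply algHom_ext
  · have hgs : g n m q ω ^ (s' * s) = g n m q ω := by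
      rw [pow_eq_pow_of_modEq hs (g_pow n m q ω), pow_one]
    simp [monomialHom_g, monomialHom_h, g_pow_mul_h_pow_pow, mul_assoc, ← pow_add, hgs,
      h_pow_eq_one_of_pow_eq_one hq.out hh]
  · simp [monomialHom_h]
  · simp [monomialHom_x]

end

theorem nonempty_bialgEquiv_of_pow_eq [NeZero n] (hω : ω ^ n = 1) (hω' : ω' ^ n = 1) {s l : ℕ}
    (hs : s.Coprime n) (hsl : ω' ^ s = q ^ l * ω) :
    Nonempty (TaftT n m q ω ≃ₐc[K] TaftT n m q ω') := by
  obtain ⟨s', hs'⟩ : ∃ s', s * s' ≡ 1 [MOD n] :=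
    ⟨(s⁻¹ : ZMod n).val,
      (ZMod.natCast_eq_natCast_iff ..).mp (by simp [ZMod.coe_mul_inv_eq_one s hs])⟩
  let l' := (m - 1) * (l * s')
  have hl : (q ^ l) ^ n = 1 := by
    simpa [mul_pow, hω, pow_right_comm ω', hω'] using congr($(hsl.symm) ^ n)
  have hl' : (q ^ l') ^ n = 1 :=
    calc (q ^ l') ^ n = ((q ^ l) ^ n) ^ ((m - 1) * s') := by ring
      _ = 1 := by rw [hl, one_pow]
  have hll' : q ^ (l * s' + l') = 1 := by
    rw [add_comm, ← Nat.succ_mul, Nat.succ_eq_add_one, Nat.sub_add_cancel NeZero.one_le, pow_mul,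
      hq.out.pow_eq_one, one_pow]
  have hl'l : q ^ (l' * s + l) = 1 :=
    calc q ^ (l' * s + l) = (q ^ l) ^ ((m - 1) * (s * s') + 1) := by ring
      _ = (q ^ l) ^ ((m - 1) * 1 + 1) := pow_eq_pow_of_modEq ((hs'.mul_left _).add_right 1) hl
      _ = 1 := by
        rw [mul_one, Nat.sub_add_cancel NeZero.one_le, pow_right_comm, hq.out.pow_eq_one, one_pow]
  have hsl' : ω ^ s' = q ^ l' * ω' := by
    calc ω ^ s' = q ^ l' * (q ^ l * ω) ^ s' := by
          rw [mul_pow, ← mul_assoc, ← pow_mul, ← pow_add, add_comm, hll', one_mul]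
      _ = q ^ l' * ω' := by rw [← hsl, ← pow_mul, pow_eq_pow_of_modEq hs' hω', pow_one]
  exact ⟨.ofBialgHom (monomialHom m hl hsl) (monomialHom m hl' hsl')
    (monomialHom_comp hl' hsl' hl hsl hs' hll')
    (monomialHom_comp hl hsl hl' hsl' (mul_comm s s' ▸ hs') hl'l)⟩

end MonomialHom

end

end TaftT

theorem theorem3p4_general {K : Type*} [Field K] {n m : ℕ} [NeZero n] [NeZero m] (hm : 1 < m)
    {q ω ω' : K} [Fact (IsPrimitiveRoot q m)] (hω : ω ^ n = 1) (hω' : ω' ^ n = 1) :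
    HopfIsomorphic K (TaftT n m q ω) (TaftT n m q ω') ↔
      ∃ l < m, ∃ s < n, s.Coprime n ∧ ω' ^ s = q ^ l * ω := by
  rw [hopfIsomorphic_iff_nonempty_bialgEquiv]
  exact ⟨fun ⟨e⟩ ↦ TaftT.exists_pow_eq_of_bialgEquiv hm hω' e,
    fun ⟨_, _, _, _, hs, hsl⟩ ↦ TaftT.nonempty_bialgEquiv_of_pow_eq hω hω' hs hsl⟩

theorem theorem3p4 {K : Type*} [Field K] (n m : ℕ) [NeZero n] [NeZero m]
    (hn : 2 ≤ n) (hm : 3 ≤ m) (q : K) [Fact (IsPrimitiveRoot q m)]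
    (ξ : Kˣ) (hξ : Subgroup.zpowers ξ = rootsOfUnity n K)
    (t t' : ℕ) (ht : t < Nat.card (rootsOfUnity n K)) (ht' : t' < Nat.card (rootsOfUnity n K)) :
    HopfIsomorphic K (TaftT n m q (ξ ^ t : K)) (TaftT n m q (ξ ^ t' : K)) ↔
      ∃ l < m, ∃ s < n, Nat.Coprime s n ∧ (ξ : K) ^ ((s : ℤ) * t' - t) = q ^ l := by
  have hξn : (ξ : K) ^ n = 1 := (mem_rootsOfUnity' n ξ).mp (hξ ▸ Subgroup.mem_zpowers ξ)
  have hpow (k : ℕ) : ((ξ : K) ^ k) ^ n = 1 := by rw [pow_right_comm, hξn, one_pow]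
  simp only [zpow_mul_sub_eq_iff ξ.ne_zero]
  exact theorem3p4_general (by lia) (hpow t) (hpow t')
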